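/- Let $X\subset\mathbb R^N$ be compact, let $f$ be a $C^1$ vector field on a neighbourhood of $X$, and let $\phi_t(x)$ denote the solution at time $t$ of $\dot x=f(x)$ in $X$ that starts at $x$ (it is defined as long as the trajectory stays in $X$; $t<0$ is allowed). Let $m$ be Lebesgue measure, let $\delta>0$, and let $B_\delta$ be the open ball of radius $\delta$ around $0$. Assume that $0\in X$ is an equilibrium, $f(0)=0$, that is almost everywhere uniformly stable: for every $\epsilon>0$ there is a $T\ge 0$ such that $\int_T^\infty m(A_t)\,dt<\epsilon$ for all measurable $A\subset X\setminus B_\delta$, where $A_t=\{x\in X:\phi_t(x)\in A\}$. For a function $z$ on $X$ and $t\ge 0$ put $$(\mathbb U_tz)(x)=z(\phi_t(x)),\qquad (\mathbb P_tz)(x)=z(\phi_{-t}(x))\,\bigl|\det D\phi_t(\phi_{-t}(x))\bigr|^{-1},$$ where the value is $0$ if the trajectory of $x$ (respectively its backward trajectory) leaves $X$ before time $t$ (respectively $-t$). For measurable $A,B\subset X\setminus B_\delta$ with indicator functions $\chi_A,\chi_B$ let $$(\mathcal C_B^\infty z)(x)=\int_0^\infty \bigl(\mathbb P_s(\chi_B\,\mathbb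 U_s z)\bigr)(x)\,ds,\qquad \rho_B(x)=\int_0^\infty(\mathbb P_t\chi_B)(x)\,dt .$$ Then the integrals that define $(\mathcal C_B^\infty\chi_A)(x)$ and $\rho_B(x)$ converge absolutely for almost every $x\in X$ and almost every $x\in A$ respectively, the functions $\mathcal C_B^\infty\chi_A$ and $\rho_B$ are integrable over $X$ and over $A$ respectively, and $$\int_X \mathcal C_B^\infty\chi_A\,dx=\int_A\rho_B\,dx=\int_B m_1\bigl(\{t\ge 0:\phi_t(x)\in A\}\bigr)\,dx ,$$ where $m_1$ is Lebesgue measure on the line; the right-hand side is the total time that the trajectories starting in $B$ spend in $A$, integrated over the starting points. If moreover no trajectory in $X$ leaves $B_\delta$ after it has entered it, then this common value is the residence time $$T_B^A=\int_B m_1\bigl(\{t\ge 0:\phi_t(x)\in A,\ \phi_s(x)\notin B_\delta\text{ for all }0\le s\le t\}\bigr)\,dx,$$ the time that the trajectories starting in $B$ spend in $A$ before they enter $B_\delta$, integrated over the starting points: $$T_B^A=\int_X\mathcal C_B^\infty\chi_A\,dx=\int_A\rho_B\,dx .$$ -/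

import Mathlib

open MeasureTheory Set

namespace Advection

/-- `N`-dimensional Euclidean space. -/
abbrev Space (N : ℕ) : Type := EuclideanSpace ℝ (Fin N)

variable {N : ℕ}

/-- `γ` solves `γ' = f(γ)`, `γ 0 = x`, on the time interval between `0` and `t`
(`t` may be negative). -/
def IsTrajectory (f : Space N → Space N) (t : ℝ) (x : Space N) (γ : ℝ → Space N) : Prop :=
  γ 0 = x ∧ IsIntegralCurveOn γ (fun _ => f) (uIcc 0 t)

/-- The trajectory of `x` exists and stays in the domain `X` at all times between `0` and `t`. -/
def StaysIn (f : Space N → Space N) (X : Set (Space N)) (t : ℝ) (x : Space N) : Prop :=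
  ∃ γ, IsTrajectory f t x γ ∧ ∀ s ∈ uIcc 0 t, γ s ∈ X

open Classical in
/-- The flow `φ_t(x)` of `x' = f(x)`: the value at time `t` of a solution that starts at `x`.
It is only meaningful where a solution exists up to time `t` and is unique; this is the case when
`StaysIn f X t x` holds and `f` is `C¹` around `X`. Elsewhere the value is arbitrary. -/
noncomputable def flow (f : Space N → Space N) (t : ℝ) (x : Space N) : Space N :=
  if h : ∃ γ, IsTrajectory f t x γ then h.choose t else x

/-- `A_t = {x ∈ X : φ_t(x) ∈ A}`, for the flow in the domain `X`. -/
def hitSet (f : Space N → Space N) (X : Set (Space N)) (t : ℝ) (A : Set (Space N)) :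
    Set (Space N) :=
  {x ∈ X | StaysIn f X t x ∧ flow f t x ∈ A}

/-- Almost everywhere uniform stability of the equilibrium `0`, with respect to its open
`δ`-neighbourhood: for every `ε > 0` there is one `T` such that `∫_T^∞ m(A_t) dt < ε` for all
measurable `A ⊆ X \ B_δ`. -/
def AEUniformlyStable (f : Space N → Space N) (X : Set (Space N)) (δ : ℝ) : Prop :=
  (0 : Space N) ∈ X ∧ f 0 = 0 ∧
    ∀ ε : ℝ, 0 < ε → ∃ T : ℝ, 0 ≤ T ∧
      ∀ A : Set (Space N), MeasurableSet A → A ⊆ X \ Metric.ball 0 δ →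
        ∫⁻ t in Ioi T, volume (hitSet f X t A) < ENNReal.ofReal ε

/-- A trajectory in `X` that has entered the open `δ`-neighbourhood of `0` remains there. -/
def NeverLeavesBall (f : Space N → Space N) (X : Set (Space N)) (δ : ℝ) : Prop :=
  ∀ x ∈ X ∩ Metric.ball 0 δ, ∀ t : ℝ, 0 ≤ t → StaysIn f X t x → flow f t x ∈ Metric.ball 0 δ

open Classical in
/-- The Koopman operator `(U_t z)(x) = z(φ_t(x))`; by the zero condition on the outflow boundary,
the value is `0` if the trajectory of `x` has left `X` before time `t`. -/
noncomputable def koopman (f : Space N → Space N) (X : Set (Space N)) (t : ℝ)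
    (z : Space N → ℝ) (x : Space N) : ℝ :=
  if StaysIn f X t x then z (flow f t x) else 0

open Classical in
/-- The Perron-Frobenius operator `(P_t z)(x) = z(y) |det Dφ_t(y)|⁻¹`, where `y = φ_{-t}(x)`;
by the zero condition on the inflow boundary, the value is `0` if the backward trajectory of `x`
leaves `X` before time `-t`. -/
noncomputable def perronFrobenius (f : Space N → Space N) (X : Set (Space N)) (t : ℝ)
    (z : Space N → ℝ) (x : Space N) : ℝ :=
  if StaysIn f X (-t) x then
    z (flow f (-t) x) * |(fderiv ℝ (flow f t) (flow f (-t) x)).det|⁻¹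
  else 0

/-- The indicator function `χ_A`. -/
noncomputable def chi (A : Set (Space N)) : Space N → ℝ := A.indicator 1

/-- The integrand `P_s (χ_B · U_s z)(x)` of the controllability gramian. -/
noncomputable def gramianIntegrand (f : Space N → Space N) (X B : Set (Space N))
    (z : Space N → ℝ) (x : Space N) (s : ℝ) : ℝ :=
  perronFrobenius f X s (fun y => chi B y * koopman f X s z y) x

/-- The infinite time controllability gramian
`(C_B^∞ z)(x) = ∫_0^∞ P_s (χ_B · U_s z)(x) ds`. -/
noncomputable def controllabilityGramian (f : Space N → Space N) (X B : Set (Space N))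
    (z : Space N → ℝ) (x : Space N) : ℝ :=
  ∫ s in Ioi (0 : ℝ), gramianIntegrand f X B z x s

/-- `ρ_B(x) = ∫_0^∞ (P_t χ_B)(x) dt`. -/
noncomputable def rho (f : Space N → Space N) (X B : Set (Space N)) (x : Space N) : ℝ :=
  ∫ t in Ioi (0 : ℝ), perronFrobenius f X t (chi B) x

/-- The residence time `T_B^A`: the time which the trajectories that start in `B` spend in `A`
before they first enter the open `δ`-neighbourhood of `0`, integrated over the starting points in
`B` with respect to Lebesgue measure. -/
noncomputable def residenceTime (f : Space N → Space N) (X : Set (Space N)) (δ : ℝ)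
    (B A : Set (Space N)) : ENNReal :=
  ∫⁻ x in B, volume {t : ℝ | 0 ≤ t ∧ StaysIn f X t x ∧
    (∀ s ∈ Icc 0 t, flow f s x ∉ Metric.ball 0 δ) ∧ flow f t x ∈ A}

/-- The total time which the trajectories that start in `B` spend in `A`, including the time after
a first visit to the neighbourhood of `0`, integrated over the starting points in `B`. -/
noncomputable def totalTime (f : Space N → Space N) (X : Set (Space N))
    (B A : Set (Space N)) : ENNReal :=
  ∫⁻ x in B, volume {t : ℝ | 0 ≤ t ∧ StaysIn f X t x ∧ flow f t x ∈ A}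

end Advection

/-! Running back and then forward along a trajectory returns to `x`, so `P_s (χ_B · U_s χ_A) = χ_A ·
P_s χ_B` and the gramian of `χ_A` is `χ_A · ρ_B` (`gramianIntegrand_chi`). The substitution `x =
φ_t(y)` turns `∫_A P_t χ_B` into the volume of the points of `B` that are in `A` at time `t`
(`setLIntegral_transportDensity`); integrated over `t`, Tonelli gives the total time
(`totalTime_eq`). It is finite: up to time `T` it is at most `T · m(X)`, and stability bounds the
tail (`totalTime_lt_top`). Hence everything is integrable and Fubini applies.

The flow in `X` is only partially defined, so `f` is replaced by a bounded Lipschitz field `g` with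
`f = g` on an open `V ⊇ X`, which has a global flow `Φ`. Each `Φ t` is bi-Lipschitz, so the change
of variables needs only differentiability almost everywhere, by Rademacher's theorem. -/

open scoped NNReal ENNReal Topology

namespace Advection

/-! ### Global flows of bounded Lipschitz fields, and local uniqueness. -/

section GlobalFlow

variable {E : Type*} [NormedAddCommGroup E] [NormedSpace ℝ E]

/-- A bounded Lipschitz vector field on a Banach space is complete. -/
theorem exists_global_solution [CompleteSpace E] {g : E → E} {K M : ℝ≥0} (hg : LipschitzWith K g)
    (hM : ∀ x, ‖g x‖ ≤ M) (x : E) :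
    ∃ γ : ℝ → E, γ 0 = x ∧ ∀ t, HasDerivAt γ (g (γ t)) t := by
  have local_solution : ∀ n : ℕ, ∃ α : ℝ → E, α 0 = x ∧
      ∀ t ∈ Ioo (-(n + 1 : ℝ)) (n + 1), HasDerivAt α (g (α t)) t := by
    intro n
    have hn : (0 : ℝ) ≤ n := n.cast_nonneg
    have h0 : (0 : ℝ) ∈ Icc (-(n + 1 : ℝ)) (n + 1) := ⟨by linarith, by linarith⟩
    -- At speed at most `M`, a curve moves at most `M * (n + 1)` in time `n + 1`; a ball of this
    -- radius does not shorten the interval of existence.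
    have hpl : IsPicardLindelof (fun _ => g) ⟨0, h0⟩ x (M * (n + 1)) 0 M K :=
      .of_time_independent (fun y _ => hM y) hg.lipschitzOnWith (by simp)
    obtain ⟨α, hα, hd⟩ := hpl.exists_eq_forall_mem_Icc_hasDerivWithinAt₀
    exact ⟨α, hα, fun t ht => (hd t (Ioo_subset_Icc_self ht)).hasDerivAt (Icc_mem_nhds ht.1 ht.2)⟩
  choose α hα hd using local_solution
  have agree : ∀ n m : ℕ, n ≤ m → EqOn (α n) (α m) (Ioo (-(n + 1 : ℝ)) (n + 1)) := by
    intro n m hnm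
    have hn : (0 : ℝ) ≤ n := n.cast_nonneg
    have hnm' : (n : ℝ) ≤ m := by exact_mod_cast hnm
    exact ODE_solution_unique_of_mem_Ioo (v := fun _ => g) (s := fun _ => univ) (t₀ := 0)
      (fun _ _ => hg.lipschitzOnWith) ⟨by linarith, by linarith⟩
      (fun t ht => ⟨hd n t ht, trivial⟩)
      (fun t ht => ⟨hd m t ⟨by linarith [ht.1], by linarith [ht.2]⟩, trivial⟩)
      ((hα n).trans (hα m).symm)
  -- The glued solution uses the index `⌈|s|⌉₊`, which jumps at integers; near a given time it can
  -- be replaced by one fixed larger index.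
  have key : ∀ (m : ℕ) (s : ℝ), |s| < m → α ⌈|s|⌉₊ s = α m s := by
    intro m s hs
    refine agree _ _ (Nat.ceil_le.2 hs.le) ?_
    have := Nat.le_ceil |s|
    exact abs_lt.1 (by linarith)
  refine ⟨fun t => α ⌈|t|⌉₊ t, by simp [hα], fun t => ?_⟩
  have hm : |t| < (⌈|t|⌉₊ + 1 : ℕ) := by
    have := Nat.le_ceil |t|
    push_cast
    linarith
  have hev : (fun t => α ⌈|t|⌉₊ t) =ᶠ[𝓝 t] α (⌈|t|⌉₊ + 1) := by
    filter_upwards [continuous_abs.continuousAt.eventually_lt_const hm] with s hs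
    exact key _ s hs
  change HasDerivAt _ (g (α ⌈|t|⌉₊ t)) t
  rw [key _ t hm]
  refine (hd _ t (abs_lt.1 ?_)).congr_of_eventuallyEq hev
  linarith

/-- Reversal of time turns solutions for `f` into solutions for `-f`. -/
theorem hasDerivWithinAt_comp_neg {f : E → E} {γ : ℝ → E} {s : Set ℝ} {t : ℝ}
    (h : HasDerivWithinAt γ (f (γ (-t))) (-s) (-t)) :
    HasDerivWithinAt (fun r => γ (-r)) ((-f) (γ (-t))) s t := by
  have := HasDerivWithinAt.scomp t h (hasDerivWithinAt_neg t s) (fun r hr => by simpa using hr)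
  simpa [Function.comp_def] using this

/-- Grönwall's inequality, with negative times reduced to positive ones for `-g`. It yields both the
group law and the Lipschitz dependence on the initial value. -/
theorem dist_solutions_le {g : E → E} {K : ℝ≥0} (hg : LipschitzWith K g) {γ η : ℝ → E}
    (hγ : ∀ t, HasDerivAt γ (g (γ t)) t) (hη : ∀ t, HasDerivAt η (g (η t)) t) (t : ℝ) :
    dist (γ t) (η t) ≤ dist (γ 0) (η 0) * Real.exp (K * |t|) := by
  have forward : ∀ {g : E → E}, LipschitzWith K g → ∀ {γ η : ℝ → E},
      (∀ t, HasDerivAt γ (g (γ t)) t) → (∀ t, HasDerivAt η (g (η t)) t) → ∀ t, 0 ≤ t →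
      dist (γ t) (η t) ≤ dist (γ 0) (η 0) * Real.exp (K * t) := by
    intro g hg γ η hγ hη t ht
    have := dist_le_of_trajectories_ODE (v := fun _ => g) (fun _ => hg)
      (fun s _ => (hγ s).continuousAt.continuousWithinAt) (fun s _ => (hγ s).hasDerivWithinAt)
      (fun s _ => (hη s).continuousAt.continuousWithinAt) (fun s _ => (hη s).hasDerivWithinAt)
      le_rfl t ⟨ht, le_rfl⟩
    simpa using this
  rcases le_total 0 t with ht | ht
  · simpa [abs_of_nonneg ht] using forward hg hγ hη t ht
  · have reverse : ∀ {γ : ℝ → E}, (∀ t, HasDerivAt γ (g (γ t)) t) →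
        ∀ t, HasDerivAt (fun r => γ (-r)) ((-g) (γ (-t))) t := fun hγ t =>
      hasDerivWithinAt_univ.1 (hasDerivWithinAt_comp_neg (hγ (-t)).hasDerivWithinAt)
    simpa [abs_of_nonpos ht] using
      forward hg.neg (reverse hγ) (reverse hη) (-t) (by linarith)

/-- `Φ` is the flow of the vector field `g`, defined at all times. -/
structure IsGlobalFlow (g : E → E) (Φ : ℝ → E → E) : Prop where
  zero : ∀ x, Φ 0 x = x
  deriv : ∀ x t, HasDerivAt (fun s => Φ s x) (g (Φ t x)) t

theorem exists_isGlobalFlow [CompleteSpace E] {g : E → E} {K M : ℝ≥0} (hg : LipschitzWith K g)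
    (hM : ∀ x, ‖g x‖ ≤ M) : ∃ Φ, IsGlobalFlow g Φ := by
  choose γ h0 hd using exists_global_solution hg hM
  exact ⟨fun t x => γ x t, h0, hd⟩

namespace IsGlobalFlow

variable {g : E → E} {Φ : ℝ → E → E} {K M : ℝ≥0}

theorem add (h : IsGlobalFlow g Φ) (hg : LipschitzWith K g) (s t : ℝ) (x : E) :
    Φ (s + t) x = Φ s (Φ t x) := by
  have h1 : ∀ r, HasDerivAt (fun r => Φ (r + t) x) (g (Φ (r + t) x)) r := fun r =>
    (h.deriv x (r + t)).comp_add_const r t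
  have := dist_solutions_le hg h1 (h.deriv (Φ t x)) s
  simpa [h.zero] using this

theorem neg_apply (h : IsGlobalFlow g Φ) (hg : LipschitzWith K g) (t : ℝ) (x : E) :
    Φ (-t) (Φ t x) = x := by
  rw [← h.add hg, neg_add_cancel, h.zero]

theorem apply_neg (h : IsGlobalFlow g Φ) (hg : LipschitzWith K g) (t : ℝ) (x : E) :
    Φ t (Φ (-t) x) = x := by
  rw [← h.add hg, add_neg_cancel, h.zero]

theorem lipschitzWith (h : IsGlobalFlow g Φ) (hg : LipschitzWith K g) (t : ℝ) :
    LipschitzWith (Real.exp (K * |t|)).toNNReal (Φ t) := by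
  refine LipschitzWith.of_dist_le_mul fun x y => ?_
  rw [Real.coe_toNNReal _ (Real.exp_pos _).le, mul_comm]
  simpa [h.zero] using dist_solutions_le hg (h.deriv x) (h.deriv y) t

theorem continuous (h : IsGlobalFlow g Φ) (hg : LipschitzWith K g) (hM : ∀ x, ‖g x‖ ≤ M) :
    Continuous Φ.uncurry := by
  refine continuous_prod_of_continuous_lipschitzWith Φ.uncurry M
    (fun t => (h.lipschitzWith hg t).continuous) (fun x => ?_)
  refine lipschitzWith_of_nnnorm_deriv_le (fun t => (h.deriv x t).differentiableAt) fun t => ?_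
  change ‖_root_.deriv (fun s => Φ s x) t‖₊ ≤ M
  rw [(h.deriv x t).deriv]
  exact hM _

end IsGlobalFlow

/-- If `f = g` on an open set `V` and `g` is Lipschitz, a solution `η` for `f` agrees with the
solution `γ` for `g` with the same initial value, as long as they stay in `V`. -/
theorem eqOn_Icc_of_eqOn_open {f g : E → E} {K : ℝ≥0} (hg : LipschitzWith K g) {V : Set E}
    (hV : IsOpen V) (hfg : EqOn f g V) {η γ : ℝ → E} {t : ℝ}
    (hη : ∀ s ∈ Icc 0 t, HasDerivWithinAt η (f (η s)) (Icc 0 t) s)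
    (hγ : ∀ s, HasDerivAt γ (g (γ s)) s) (hγV : ∀ s ∈ Icc 0 t, η s = γ s → γ s ∈ V)
    (h0 : η 0 = γ 0) : EqOn η γ (Icc 0 t) := by
  have hηc : ContinuousOn η (Icc 0 t) := fun s hs => (hη s hs).continuousWithinAt
  have hγc : Continuous γ := continuous_iff_continuousAt.2 fun s => (hγ s).continuousAt
  have hclosed : IsClosed ({s | η s = γ s} ∩ Icc 0 t) := by
    have : {s | η s = γ s} ∩ Icc 0 t = Icc 0 t ∩ {s | (η s, γ s) ∈ {p : E × E | p.1 = p.2}} := by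
      ext; simp [and_comm]
    rw [this]
    exact (hηc.prodMk hγc.continuousOn).preimage_isClosed_of_isClosed isClosed_Icc
      (isClosed_eq continuous_fst continuous_snd)
  -- Continuous induction: at a time of agreement both curves are in the open set `V`, so `η` stays
  -- in `V` for a short while, solves the equation for `g` there, and uniqueness extends the
  -- agreement.
  refine hclosed.Icc_subset_of_forall_mem_nhdsWithin h0 ?_
  rintro a ⟨ha, ha0, hat⟩
  have haI : a ∈ Icc 0 t := ⟨ha0, hat.le⟩
  have haV := hγV a haI ha
  have hin : ∀ᶠ s in 𝓝[≥] a, η s ∈ V := by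
    have h1 : ContinuousWithinAt η (Icc a t) a := (hηc a haI).mono (Icc_subset_Icc_left ha0)
    have h2 : ∀ᶠ s in 𝓝[Icc a t] a, η s ∈ V :=
      h1.eventually (hV.mem_nhds (by rw [show η a = γ a from ha]; exact haV))
    rwa [nhdsWithin_Icc_eq_nhdsGE hat] at h2
  obtain ⟨b, hab, hb⟩ := mem_nhdsGE_iff_exists_Icc_subset.1 hin
  have hab' : a < min b t := lt_min hab hat
  have heq : EqOn η γ (Icc a (min b t)) := by
    refine ODE_solution_unique (v := fun _ => g) (fun _ => hg)
      (hηc.mono (Icc_subset_Icc ha0 (min_le_right _ _))) (fun s hs => ?_) hγc.continuousOn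
      (fun s _ => (hγ s).hasDerivWithinAt) ha
    have hst : s < t := hs.2.trans_le (min_le_right _ _)
    have hsV : η s ∈ V := hb ⟨hs.1, (hs.2.trans_le (min_le_left _ _)).le⟩
    have := (hη s ⟨ha0.trans hs.1, hst.le⟩).mono (Icc_subset_Icc_left (ha0.trans hs.1))
    rw [hfg hsV] at this
    exact this.mono_of_mem_nhdsWithin (Icc_mem_nhdsGE hst)
  exact Filter.mem_of_superset (Ioc_mem_nhdsGT hab') fun s hs => heq (Ioc_subset_Icc_self hs)

theorem eqOn_uIcc_of_eqOn_open {f g : E → E} {K : ℝ≥0} (hg : LipschitzWith K g) {V : Set E}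
    (hV : IsOpen V) (hfg : EqOn f g V) {η γ : ℝ → E} {t : ℝ}
    (hη : ∀ s ∈ uIcc 0 t, HasDerivWithinAt η (f (η s)) (uIcc 0 t) s)
    (hγ : ∀ s, HasDerivAt γ (g (γ s)) s) (hγV : ∀ s ∈ uIcc 0 t, η s = γ s → γ s ∈ V)
    (h0 : η 0 = γ 0) : EqOn η γ (uIcc 0 t) := by
  rcases le_total 0 t with ht | ht
  · rw [uIcc_of_le ht] at *
    exact eqOn_Icc_of_eqOn_open hg hV hfg hη hγ hγV h0
  · rw [uIcc_of_ge ht] at *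
    have hmem : ∀ s ∈ Icc 0 (-t), -s ∈ Icc t 0 := fun s hs =>
      ⟨by linarith [hs.2], by linarith [hs.1]⟩
    have := eqOn_Icc_of_eqOn_open (f := -f) (η := fun s => η (-s)) (γ := fun s => γ (-s)) hg.neg hV
      (fun x hx => by simp [hfg hx])
      (fun s hs => hasDerivWithinAt_comp_neg (by simpa using hη (-s) (hmem s hs)))
      (fun s => hasDerivWithinAt_univ.1 (hasDerivWithinAt_comp_neg (hγ (-s)).hasDerivWithinAt))
      (fun s hs => hγV (-s) (hmem s hs)) (by simpa using h0)
    intro s hs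
    simpa using this (show -s ∈ Icc 0 (-t) from ⟨by linarith [hs.2], by linarith [hs.1]⟩)

end GlobalFlow

/-! ### Replacing the partial flow in `X` by a global flow. -/

/-- A vector field that is `C¹` around a compact set agrees, near that set, with a bounded
Lipschitz vector field. -/
theorem exists_lipschitz_extension {N : ℕ} {X : Set (Space N)} (hX : IsCompact X)
    {f : Space N → Space N} (hf : ∀ x ∈ X, ContDiffAt ℝ 1 f x) :
    ∃ (g : Space N → Space N) (K M : ℝ≥0) (V : Set (Space N)), LipschitzWith K g ∧
      (∀ x, ‖g x‖ ≤ M) ∧ IsOpen V ∧ X ⊆ V ∧ EqOn f g V := by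
  have hU : IsOpen {x | ContDiffAt ℝ 1 f x} :=
    isOpen_iff_mem_nhds.2 fun x hx =>
      ContDiffAt.eventually (show ContDiffAt ℝ 1 f x from hx) (by simp)
  obtain ⟨L, hL, hXL, hLU⟩ := exists_compact_between hX hU hf
  -- The extension is `χ • f` for a cutoff `χ` that is `1` near `X` and `0` off the compact set `L`,
  -- on which `f` is `C¹`.
  obtain ⟨χ, hχ1, hχ0, -⟩ := exists_contMDiffMap_one_nhds_of_subset_interior
    (n := (1 : ℕ∞)) (modelWithCornersSelf ℝ (Space N)) hX.isClosed hXL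
  have hχ : ContDiff ℝ 1 χ := χ.contMDiff.contDiff
  have hg : ContDiff ℝ 1 (fun x => χ x • f x) := by
    refine contDiff_iff_contDiffAt.2 fun x => ?_
    by_cases hx : x ∈ L
    · exact hχ.contDiffAt.smul (hLU hx)
    · refine (contDiffAt_const (c := (0 : Space N))).congr_of_eventuallyEq ?_
      filter_upwards [hL.isClosed.isOpen_compl.mem_nhds hx] with y hy
      simp [hχ0 y hy]
  have hgc : HasCompactSupport (fun x => χ x • f x) :=
    HasCompactSupport.intro hL fun x hx => by simp [hχ0 x hx]
  obtain ⟨K, hK⟩ := hg.lipschitzWith_of_hasCompactSupport hgc one_ne_zero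
  obtain ⟨M, hM⟩ := hgc.exists_bound_of_continuous hg.continuous
  obtain ⟨V, hV, hXV, hV1⟩ := mem_nhdsSet_iff_exists.1 hχ1
  exact ⟨_, K, M.toNNReal, V, hK, fun x => (hM x).trans (Real.le_coe_toNNReal M), hV, hXV,
    fun x hx => by simp [show χ x = 1 from hV1 hx]⟩

section Identification

variable {f g : Space N → Space N} {Φ : ℝ → Space N → Space N} {K : ℝ≥0} {X V : Set (Space N)}

/-- Membership in `V` is required only at times of agreement, so it can be checked on either curve:
on `γ` in `staysIn_iff`, on `Φ` in `flow_eq`. -/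
theorem IsTrajectory.eqOn_globalFlow (hΦ : IsGlobalFlow g Φ) (hg : LipschitzWith K g)
    (hV : IsOpen V) (hfg : EqOn f g V) {t : ℝ} {x : Space N} {γ : ℝ → Space N}
    (hγ : IsTrajectory f t x γ) (h : ∀ s ∈ uIcc 0 t, γ s = Φ s x → Φ s x ∈ V) :
    EqOn γ (fun s => Φ s x) (uIcc 0 t) :=
  eqOn_uIcc_of_eqOn_open hg hV hfg hγ.2 (hΦ.deriv x) h (by simp [hγ.1, hΦ.zero])

theorem isTrajectory_globalFlow (hΦ : IsGlobalFlow g Φ) (hfg : EqOn f g V) {t : ℝ} {x : Space N}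
    (h : ∀ s ∈ uIcc 0 t, Φ s x ∈ V) : IsTrajectory f t x (fun s => Φ s x) :=
  ⟨hΦ.zero x, fun s hs => by
    simpa [hfg (h s hs)] using (hΦ.deriv x s).hasDerivWithinAt⟩

theorem staysIn_iff (hΦ : IsGlobalFlow g Φ) (hg : LipschitzWith K g) (hV : IsOpen V)
    (hfg : EqOn f g V) (hXV : X ⊆ V) {t : ℝ} {x : Space N} :
    StaysIn f X t x ↔ ∀ s ∈ uIcc 0 t, Φ s x ∈ X := by
  refine ⟨fun ⟨γ, hγ, hX⟩ s hs => ?_, fun h =>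
    ⟨_, isTrajectory_globalFlow hΦ hfg fun s hs => hXV (h s hs), h⟩⟩
  have heq := hγ.eqOn_globalFlow hΦ hg hV hfg (fun r hr he => he ▸ hXV (hX r hr)) hs
  exact (show γ s = Φ s x from heq) ▸ hX s hs

theorem flow_eq (hΦ : IsGlobalFlow g Φ) (hg : LipschitzWith K g) (hV : IsOpen V)
    (hfg : EqOn f g V) {t : ℝ} {x : Space N} (h : ∀ s ∈ uIcc 0 t, Φ s x ∈ V) :
    flow f t x = Φ t x := by
  have hex : ∃ γ, IsTrajectory f t x γ := ⟨_, isTrajectory_globalFlow hΦ hfg h⟩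
  rw [flow, dif_pos hex]
  exact hex.choose_spec.eqOn_globalFlow hΦ hg hV hfg (fun s hs _ => h s hs) right_mem_uIcc

/-- Needed because the Jacobian in `perronFrobenius` depends on the germ of `flow f t`. Nearby
trajectories may leave `X`, but they remain in the open set `V`. -/
theorem flow_eventuallyEq (hΦ : IsGlobalFlow g Φ) (hg : LipschitzWith K g)
    (hc : Continuous Φ.uncurry) (hV : IsOpen V) (hfg : EqOn f g V) {t : ℝ} {x : Space N}
    (h : ∀ s ∈ uIcc 0 t, Φ s x ∈ V) : flow f t =ᶠ[𝓝 x] Φ t := by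
  have : ∀ᶠ y in 𝓝 x, ∀ s ∈ uIcc 0 t, Φ s y ∈ V := by
    refine isCompact_uIcc.eventually_forall_of_forall_eventually fun s hs => ?_
    exact (hc.comp continuous_swap).continuousAt.eventually (hV.mem_nhds (h s hs))
  filter_upwards [this] with y hy using flow_eq hΦ hg hV hfg hy

end Identification

/-! ### Change of variables for bi-Lipschitz maps. -/

/-- Lipschitz maps of a Euclidean space map null sets to null sets. -/
theorem volume_image_eq_zero_of_lipschitz {C : ℝ≥0} {φ : Space N → Space N}
    (hφ : LipschitzWith C φ) {s : Set (Space N)} (hs : volume s = 0) : volume (φ '' s) = 0 := by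
  have h1 : (volume : Measure (Space N)) ≪ μH[Module.finrank ℝ (Space N)] :=
    Measure.absolutelyContinuous_isAddHaarMeasure _ _
  have h2 : μH[Module.finrank ℝ (Space N)] ≪ (volume : Measure (Space N)) :=
    Measure.absolutelyContinuous_isAddHaarMeasure _ _
  refine h1 (nonpos_iff_eq_zero.1 ?_)
  refine (hφ.hausdorffMeasure_image_le (Nat.cast_nonneg _) s).trans ?_
  rw [h2 hs, mul_zero]

/-- Change of variables for a bi-Lipschitz homeomorphism: the push-forward of Lebesgue measure has
density `|det Dφ|⁻¹ ∘ φ⁻¹`. -/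
theorem lintegral_indicator_inv_det {C C' : ℝ≥0} {φ ψ : Space N → Space N}
    (hφ : LipschitzWith C φ) (hψ : LipschitzWith C' ψ) (hψφ : Function.LeftInverse ψ φ)
    (hφψ : Function.RightInverse ψ φ) {S : Set (Space N)} (hS : MeasurableSet S) :
    ∫⁻ x, S.indicator (fun y => ENNReal.ofReal |(fderiv ℝ φ y).det|⁻¹) (ψ x) = volume S := by
  have himage : ∀ s, φ '' s = ψ ⁻¹' s := congrFun (image_eq_preimage_of_inverse hψφ hφψ)
  -- The complement of `R` is null: Rademacher's theorem handles non-differentiability, and the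
  -- critical points have a null image, which the Lipschitz inverse `ψ` carries back to a null set.
  let R : Set (Space N) := {y | DifferentiableAt ℝ φ y ∧ (fderiv ℝ φ y).det ≠ 0}
  have hdet : Measurable fun y => (fderiv ℝ φ y).det :=
    ContinuousLinearMap.continuous_det.measurable.comp (measurable_fderiv ℝ φ)
  have hR : MeasurableSet R :=
    (measurableSet_of_differentiableAt ℝ φ).inter (hdet (measurableSet_singleton 0).compl)
  have hR0 : volume Rᶜ = 0 := by
    have h1 : volume {y | ¬ DifferentiableAt ℝ φ y} = 0 := hφ.ae_differentiableAt
    have h2 : volume {y | DifferentiableAt ℝ φ y ∧ (fderiv ℝ φ y).det = 0} = 0 := by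
      have := addHaar_image_eq_zero_of_det_fderivWithin_eq_zero volume (f := φ)
        (s := {y | DifferentiableAt ℝ φ y ∧ (fderiv ℝ φ y).det = 0})
        (fun y hy => hy.1.hasFDerivAt.hasFDerivWithinAt) (fun y hy => hy.2)
      have := volume_image_eq_zero_of_lipschitz hψ this
      rwa [← image_comp, hψφ.comp_eq_id, image_id] at this
    refine measure_mono_null (fun y hy => ?_) (measure_union_null h1 h2)
    by_cases hd : DifferentiableAt ℝ φ y
    · exact Or.inr ⟨hd, by_contra fun h => hy ⟨hd, h⟩⟩
    · exact Or.inl hd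
  have hae : ∀ᵐ x, ψ x ∈ R := by
    have := volume_image_eq_zero_of_lipschitz hφ hR0
    rwa [himage] at this
  calc ∫⁻ x, S.indicator (fun y => ENNReal.ofReal |(fderiv ℝ φ y).det|⁻¹) (ψ x)
      = ∫⁻ x, (φ '' (S ∩ R)).indicator
          (fun x => ENNReal.ofReal |(fderiv ℝ φ (ψ x)).det|⁻¹) x := by
        refine lintegral_congr_ae ?_
        filter_upwards [hae] with x hx
        by_cases hxS : ψ x ∈ S
        · simp [himage, hxS, hx]
        · simp [himage, hxS]
    _ = ∫⁻ x in φ '' (S ∩ R), ENNReal.ofReal |(fderiv ℝ φ (ψ x)).det|⁻¹ := by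
        rw [lintegral_indicator]
        rw [himage]
        exact hψ.continuous.measurable (hS.inter hR)
    _ = ∫⁻ y in S ∩ R, ENNReal.ofReal |(fderiv ℝ φ y).det| *
          ENNReal.ofReal |(fderiv ℝ φ (ψ (φ y))).det|⁻¹ :=
        lintegral_image_eq_lintegral_abs_det_fderiv_mul volume (hS.inter hR)
          (fun y hy => hy.2.1.hasFDerivAt.hasFDerivWithinAt) hψφ.injective.injOn _
    _ = ∫⁻ _ in S ∩ R, 1 := by
        refine setLIntegral_congr_fun (hS.inter hR) fun y hy => ?_
        have : |(fderiv ℝ φ y).det| ≠ 0 := abs_ne_zero.2 hy.2.2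
        simp only [hψφ y]
        rw [← ENNReal.ofReal_mul (abs_nonneg _), mul_inv_cancel₀ this, ENNReal.ofReal_one]
    _ = volume S := by
        rw [setLIntegral_one]
        exact measure_inter_conull hR0

/-! ### The transported density and its integral. -/

/-- The pairs `(t, y)`, `t ≥ 0`, `y ∈ B`, such that the `Φ`-trajectory of `y` stays in `X`
up to time `t`. -/
def survivalSet (Φ : ℝ → Space N → Space N) (X B : Set (Space N)) : Set (ℝ × Space N) :=
  {p | 0 ≤ p.1 ∧ p.2 ∈ B ∧ ∀ r ∈ Icc 0 p.1, Φ r p.2 ∈ X}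

/-- `(P_t χ_B)(x)` as a function of `(t, x)`, in terms of a globally defined flow. -/
noncomputable def transportDensity (Φ : ℝ → Space N → Space N) (X B : Set (Space N))
    (p : ℝ × Space N) : ℝ :=
  (survivalSet Φ X B).indicator (fun q => |(fderiv ℝ (Φ q.1) q.2).det|⁻¹) (p.1, Φ (-p.1) p.2)

section

variable {Φ : ℝ → Space N → Space N} {X A B : Set (Space N)}

theorem measurableSet_survivalSet (hc : Continuous Φ.uncurry) (hX : IsClosed X)
    (hB : MeasurableSet B) : MeasurableSet (survivalSet Φ X B) := by
  -- Writing `r = u * t` makes the range of the quantifier independent of `t`, so the condition is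
  -- an intersection of closed ones.
  have hclosed : IsClosed {p : ℝ × Space N | ∀ u ∈ Icc (0 : ℝ) 1, Φ (u * p.1) p.2 ∈ X} := by
    have : {p : ℝ × Space N | ∀ u ∈ Icc (0 : ℝ) 1, Φ (u * p.1) p.2 ∈ X} =
        ⋂ u ∈ Icc (0 : ℝ) 1, (fun p : ℝ × Space N => Φ.uncurry (u * p.1, p.2)) ⁻¹' X := by
      ext; simp
    rw [this]
    exact isClosed_biInter fun u _ => hX.preimage (hc.comp (by fun_prop))
  have : survivalSet Φ X B = {p | 0 ≤ p.1} ∩ (Prod.snd ⁻¹' B) ∩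
      {p | ∀ u ∈ Icc (0 : ℝ) 1, Φ (u * p.1) p.2 ∈ X} := by
    ext ⟨t, y⟩
    simp only [survivalSet, mem_ofPred_eq, mem_inter_iff, mem_preimage, and_assoc]
    refine and_congr_right fun ht => and_congr_right fun _ => ⟨fun h u hu => ?_, fun h r hr => ?_⟩
    · exact h _ ⟨mul_nonneg hu.1 ht, mul_le_of_le_one_left ht hu.2⟩
    · rcases ht.eq_or_lt with rfl | ht'
      · simpa [le_antisymm hr.2 hr.1] using h 0 (by simp)
      · simpa [div_mul_cancel₀ _ ht'.ne'] using
          h (r / t) ⟨div_nonneg hr.1 ht, (div_le_one ht').2 hr.2⟩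
  rw [this]
  exact ((measurableSet_le measurable_const measurable_fst).inter (measurable_snd hB)).inter
    hclosed.measurableSet

theorem transportDensity_nonneg (p : ℝ × Space N) : 0 ≤ transportDensity Φ X B p :=
  indicator_nonneg (fun _ _ => inv_nonneg.2 (abs_nonneg _)) _

theorem measurable_transportDensity (hc : Continuous Φ.uncurry) (hX : IsClosed X)
    (hB : MeasurableSet B) : Measurable (transportDensity Φ X B) := by
  have h1 : Measurable fun q : ℝ × Space N => |(fderiv ℝ (Φ q.1) q.2).det|⁻¹ := by
    have := ContinuousLinearMap.continuous_det.measurable.comp (measurable_fderiv_with_param ℝ hc)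
    exact (continuous_abs.measurable.comp this).inv
  have h2 : Measurable fun p : ℝ × Space N => (p.1, Φ (-p.1) p.2) := by
    have : Continuous fun p : ℝ × Space N => Φ.uncurry (-p.1, p.2) := hc.comp (by fun_prop)
    exact measurable_fst.prodMk this.measurable
  exact (h1.indicator (measurableSet_survivalSet hc hX hB)).comp h2

variable {g : Space N → Space N} {K : ℝ≥0}

theorem setLIntegral_transportDensity (hΦ : IsGlobalFlow g Φ) (hg : LipschitzWith K g)
    (hc : Continuous Φ.uncurry) (hX : IsClosed X) (hA : MeasurableSet A) (hB : MeasurableSet B)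
    (t : ℝ) :
    ∫⁻ x in A, ENNReal.ofReal (transportDensity Φ X B (t, x)) =
      volume {y | (t, y) ∈ survivalSet Φ X B ∧ Φ t y ∈ A} := by
  have hS : MeasurableSet {y | (t, y) ∈ survivalSet Φ X B ∧ Φ t y ∈ A} :=
    ((measurableSet_survivalSet hc hX hB).preimage measurable_prodMk_left).inter
      ((hΦ.lipschitzWith hg t).continuous.measurable hA)
  rw [← lintegral_indicator_inv_det (hΦ.lipschitzWith hg t) (hΦ.lipschitzWith hg (-t))
    (hΦ.neg_apply hg t) (hΦ.apply_neg hg t) hS, ← lintegral_indicator hA]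
  refine lintegral_congr fun x => ?_
  by_cases hx : x ∈ A <;> by_cases hT : (t, Φ (-t) x) ∈ survivalSet Φ X B <;>
    simp [hx, hT, transportDensity, hΦ.apply_neg hg]

theorem lintegral_transportDensity (hΦ : IsGlobalFlow g Φ) (hg : LipschitzWith K g)
    (hc : Continuous Φ.uncurry) (hX : IsClosed X) (hA : MeasurableSet A) (hB : MeasurableSet B) :
    ∫⁻ p, ENNReal.ofReal (transportDensity Φ X B p)
        ∂((volume.restrict (Ioi (0 : ℝ))).prod (volume.restrict A)) =
      ∫⁻ t in Ioi (0 : ℝ), volume {y | (t, y) ∈ survivalSet Φ X B ∧ Φ t y ∈ A} := by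
  rw [lintegral_prod _ (measurable_transportDensity hc hX hB).ennreal_ofReal.aemeasurable]
  exact lintegral_congr fun t => setLIntegral_transportDensity hΦ hg hc hX hA hB t

/-! ### Translation back to the operators and times defined by `f`. -/

variable {f : Space N → Space N} {V : Set (Space N)}

theorem mem_survivalSet_iff (hΦ : IsGlobalFlow g Φ) (hg : LipschitzWith K g) (hV : IsOpen V)
    (hfg : EqOn f g V) (hXV : X ⊆ V) {t : ℝ} (ht : 0 ≤ t) {y : Space N} :
    (t, y) ∈ survivalSet Φ X B ↔ y ∈ B ∧ StaysIn f X t y := by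
  simp [survivalSet, staysIn_iff hΦ hg hV hfg hXV, ht]

/-- Both sides concern the same orbit segment, traversed from opposite ends. -/
theorem staysIn_neg_iff (hΦ : IsGlobalFlow g Φ) (hg : LipschitzWith K g) (hV : IsOpen V)
    (hfg : EqOn f g V) (hXV : X ⊆ V) {t : ℝ} {x : Space N} :
    StaysIn f X (-t) x ↔ StaysIn f X t (Φ (-t) x) := by
  simp only [staysIn_iff hΦ hg hV hfg hXV, ← hΦ.add hg]
  constructor
  · intro h s hs
    refine h _ ?_
    rw [mem_uIcc] at hs ⊢
    grind
  · intro h s hs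
    have := h (s + t) (by rw [mem_uIcc] at hs ⊢; grind)
    simpa using this

theorem flow_eq_of_staysIn (hΦ : IsGlobalFlow g Φ) (hg : LipschitzWith K g) (hV : IsOpen V)
    (hfg : EqOn f g V) (hXV : X ⊆ V) {t : ℝ} {x : Space N} (h : StaysIn f X t x) :
    flow f t x = Φ t x :=
  flow_eq hΦ hg hV hfg fun s hs => hXV ((staysIn_iff hΦ hg hV hfg hXV).1 h s hs)

theorem perronFrobenius_chi (hΦ : IsGlobalFlow g Φ) (hg : LipschitzWith K g)
    (hc : Continuous Φ.uncurry) (hV : IsOpen V) (hfg : EqOn f g V) (hXV : X ⊆ V) {t : ℝ}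
    (ht : 0 ≤ t) (x : Space N) :
    perronFrobenius f X t (chi B) x = transportDensity Φ X B (t, x) := by
  have hmem := mem_survivalSet_iff (B := B) (y := Φ (-t) x) hΦ hg hV hfg hXV ht
  rw [← staysIn_neg_iff hΦ hg hV hfg hXV] at hmem
  by_cases hs : StaysIn f X (-t) x
  · have hs' := (staysIn_neg_iff hΦ hg hV hfg hXV).1 hs
    rw [perronFrobenius, if_pos hs, flow_eq_of_staysIn hΦ hg hV hfg hXV hs,
      (flow_eventuallyEq hΦ hg hc hV hfg fun s hs =>
        hXV ((staysIn_iff hΦ hg hV hfg hXV).1 hs' s hs)).fderiv_eq]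
    by_cases hB : Φ (-t) x ∈ B <;> simp [chi, transportDensity, hmem, hB, hs]
  · simp [perronFrobenius, transportDensity, hmem, hs]

/-- The integrand of the gramian vanishes off `A`, and on `A` it is the integrand of `ρ_B`. -/
theorem gramianIntegrand_chi (hΦ : IsGlobalFlow g Φ) (hg : LipschitzWith K g) (hV : IsOpen V)
    (hfg : EqOn f g V) (hXV : X ⊆ V) (x : Space N) (t : ℝ) :
    gramianIntegrand f X B (chi A) x t =
      A.indicator (fun x => perronFrobenius f X t (chi B) x) x := by
  by_cases hs : StaysIn f X (-t) x
  · have hs' := (staysIn_neg_iff hΦ hg hV hfg hXV).1 hs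
    have h1 : koopman f X t (chi A) (Φ (-t) x) = chi A x := by
      rw [koopman, if_pos hs', flow_eq_of_staysIn hΦ hg hV hfg hXV hs', hΦ.apply_neg hg]
    by_cases hx : x ∈ A <;>
      simp [gramianIntegrand, perronFrobenius, hs, flow_eq_of_staysIn hΦ hg hV hfg hXV hs, h1, hx,
        show chi A x = A.indicator 1 x from rfl]
  · by_cases hx : x ∈ A <;> simp [gramianIntegrand, perronFrobenius, hs, hx]

/-- Tonelli: the product measure of one set of pairs `(t, y)`, computed by slices in either order.
-/
theorem totalTime_eq (hΦ : IsGlobalFlow g Φ) (hg : LipschitzWith K g)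
    (hc : Continuous Φ.uncurry) (hX : IsClosed X) (hV : IsOpen V) (hfg : EqOn f g V) (hXV : X ⊆ V)
    (hA : MeasurableSet A) (hB : MeasurableSet B) :
    totalTime f X B A =
      ∫⁻ t in Ioi (0 : ℝ), volume {y | (t, y) ∈ survivalSet Φ X B ∧ Φ t y ∈ A} := by
  let S : Set (ℝ × Space N) := survivalSet Φ X B ∩ Φ.uncurry ⁻¹' A
  have hS : MeasurableSet S := (measurableSet_survivalSet hc hX hB).inter (hc.measurable hA)
  have h0 : ∀ t < 0, volume (Prod.mk t ⁻¹' S) = 0 := fun t ht => by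
    simp [S, survivalSet, preimage, ht.not_ge]
  have hprod := (Measure.prod_apply (μ := (volume : Measure ℝ))
    (ν := (volume : Measure (Space N))) hS).symm.trans (Measure.prod_apply_symm hS)
  have hleft : ∫⁻ t, volume (Prod.mk t ⁻¹' S) = ∫⁻ t in Ioi (0 : ℝ), volume (Prod.mk t ⁻¹' S) := by
    rw [← setLIntegral_congr Ioi_ae_eq_Ici.symm, ← lintegral_indicator measurableSet_Ici]
    refine lintegral_congr fun t => ?_
    by_cases ht : 0 ≤ t
    · simp [ht]
    · simpa [ht] using h0 t (not_le.1 ht)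
  have hright : ∫⁻ y, volume ((fun t => (t, y)) ⁻¹' S) = totalTime f X B A := by
    rw [totalTime, ← lintegral_indicator hB]
    refine lintegral_congr fun y => ?_
    by_cases hy : y ∈ B
    · rw [indicator_of_mem hy]
      congr 1
      ext t
      constructor
      · rintro ⟨hT, hA⟩
        have ht : 0 ≤ t := hT.1
        have hs := ((mem_survivalSet_iff hΦ hg hV hfg hXV ht).1 hT).2
        exact ⟨ht, hs, by rw [flow_eq_of_staysIn hΦ hg hV hfg hXV hs]; exact hA⟩
      · rintro ⟨ht, hs, hA⟩
        rw [flow_eq_of_staysIn hΦ hg hV hfg hXV hs] at hA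
        exact ⟨(mem_survivalSet_iff hΦ hg hV hfg hXV ht).2 ⟨hy, hs⟩, hA⟩
    · have : (fun t => (t, y)) ⁻¹' S = ∅ := by
        ext t
        simp [S, survivalSet, hy]
      simp [this, hy]
  rw [← hright, ← hprod, hleft]
  rfl

/-- Almost everywhere uniform stability makes the total time finite. -/
theorem totalTime_lt_top {δ : ℝ} (hX : IsCompact X) (hstable : AEUniformlyStable f X δ)
    (hΦ : IsGlobalFlow g Φ) (hg : LipschitzWith K g) (hc : Continuous Φ.uncurry) (hV : IsOpen V)
    (hfg : EqOn f g V) (hXV : X ⊆ V) (hA : MeasurableSet A) (hB : MeasurableSet B)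
    (hAX : A ⊆ X \ Metric.ball 0 δ) (hBX : B ⊆ X) : totalTime f X B A < ∞ := by
  -- Only finiteness of the tail matters, so any positive `ε` would do.
  obtain ⟨T, hT, hTA⟩ := hstable.2.2 1 one_pos
  have hsub : ∀ t, volume {y | (t, y) ∈ survivalSet Φ X B ∧ Φ t y ∈ A} ≤
      volume (hitSet f X t A) := by
    refine fun t => measure_mono ?_
    rintro y ⟨hy, hyA⟩
    obtain ⟨hyB, hs⟩ := (mem_survivalSet_iff hΦ hg hV hfg hXV hy.1).1 hy
    exact ⟨hBX hyB, hs, by rwa [flow_eq_of_staysIn hΦ hg hV hfg hXV hs]⟩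
  rw [totalTime_eq hΦ hg hc hX.isClosed hV hfg hXV hA hB]
  calc ∫⁻ t in Ioi (0 : ℝ), volume {y | (t, y) ∈ survivalSet Φ X B ∧ Φ t y ∈ A}
      ≤ ∫⁻ t in Ioi (0 : ℝ), volume (hitSet f X t A) := lintegral_mono hsub
    _ ≤ (∫⁻ t in Ioc 0 T, volume (hitSet f X t A)) + ∫⁻ t in Ioi T, volume (hitSet f X t A) := by
        rw [← Ioc_union_Ioi_eq_Ioi hT]
        exact lintegral_union_le _ _ _
    _ ≤ (∫⁻ _ in Ioc 0 T, volume X) + ENNReal.ofReal 1 :=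
        add_le_add (lintegral_mono fun t => measure_mono fun y hy => hy.1) (hTA A hA hAX).le
    _ < ∞ := by
        rw [setLIntegral_const]
        exact ENNReal.add_lt_top.2
          ⟨ENNReal.mul_lt_top hX.measure_lt_top measure_Ioc_lt_top, ENNReal.ofReal_lt_top⟩

/-- A visit to the ball at a time `s ≤ t` would last until time `t`, by the group law applied to `t
- s` and `s`; but `A` is disjoint from the ball. -/
theorem residenceTime_eq_totalTime {δ : ℝ} (hΦ : IsGlobalFlow g Φ) (hg : LipschitzWith K g)
    (hV : IsOpen V) (hfg : EqOn f g V) (hXV : X ⊆ V) (hAX : A ⊆ X \ Metric.ball 0 δ)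
    (hball : NeverLeavesBall f X δ) : residenceTime f X δ B A = totalTime f X B A := by
  refine lintegral_congr fun x => congrArg volume (ext fun t => ?_)
  refine ⟨fun h => ⟨h.1, h.2.1, h.2.2.2⟩, fun ⟨ht, hs, hA⟩ => ⟨ht, hs, fun s hst hsB => ?_, hA⟩⟩
  have hX := (staysIn_iff hΦ hg hV hfg hXV).1 hs
  rw [uIcc_of_le ht] at hX
  have hs1 : StaysIn f X s x := (staysIn_iff hΦ hg hV hfg hXV).2 fun r hr => by
    rw [uIcc_of_le hst.1] at hr
    exact hX r ⟨hr.1, hr.2.trans hst.2⟩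
  have hs2 : StaysIn f X (t - s) (Φ s x) := (staysIn_iff hΦ hg hV hfg hXV).2 fun r hr => by
    rw [uIcc_of_le (sub_nonneg.2 hst.2)] at hr
    rw [← hΦ.add hg]
    exact hX _ ⟨add_nonneg hr.1 hst.1, by linarith [hr.2]⟩
  rw [flow_eq_of_staysIn hΦ hg hV hfg hXV hs1] at hsB
  have := hball _ ⟨hX s hst, hsB⟩ (t - s) (sub_nonneg.2 hst.2) hs2
  rw [flow_eq_of_staysIn hΦ hg hV hfg hXV hs2, ← hΦ.add hg, sub_add_cancel,
    ← flow_eq_of_staysIn hΦ hg hV hfg hXV hs] at this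
  exact (hAX hA).2 this

end

end Advection

/-! ### Assembly by Fubini. -/

theorem mainTheorem10 (N : ℕ) (X : Set (Advection.Space N)) (hX : IsCompact X)
    (f : Advection.Space N → Advection.Space N) (hf : ∀ x ∈ X, ContDiffAt ℝ 1 f x)
    (δ : ℝ) (hδ : 0 < δ) (hstable : Advection.AEUniformlyStable f X δ)
    (A B : Set (Advection.Space N)) (hA : MeasurableSet A) (hB : MeasurableSet B)
    (hAX : A ⊆ X \ Metric.ball 0 δ) (hBX : B ⊆ X \ Metric.ball 0 δ) :
    -- the integrals that define `C_B^∞ χ_A` and `ρ_B` converge, and so do those of the formula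
    (∀ᵐ x ∂(volume.restrict X),
      IntegrableOn (Advection.gramianIntegrand f X B (Advection.chi A) x) (Ioi 0)) ∧
    (∀ᵐ x ∂(volume.restrict A),
      IntegrableOn (fun t => Advection.perronFrobenius f X t (Advection.chi B) x) (Ioi 0)) ∧
    IntegrableOn (Advection.controllabilityGramian f X B (Advection.chi A)) X ∧
    IntegrableOn (Advection.rho f X B) A ∧
    -- the two formulas agree
    (∫ x in X, Advection.controllabilityGramian f X B (Advection.chi A) x) =
      ∫ x in A, Advection.rho f X B x ∧
    -- they give the total time that trajectories from `B` spend in `A`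
    Advection.totalTime f X B A =
      ENNReal.ofReal
        (∫ x in X, Advection.controllabilityGramian f X B (Advection.chi A) x) ∧
    -- and the time before they enter `B_δ`, if no trajectory leaves `B_δ` again
    (Advection.NeverLeavesBall f X δ →
      Advection.residenceTime f X δ B A =
        ENNReal.ofReal
          (∫ x in X, Advection.controllabilityGramian f X B (Advection.chi A) x)) := by
  open Advection in
  obtain ⟨g, K, M, V, hg, hM, hV, hXV, hfg⟩ := exists_lipschitz_extension hX hf
  obtain ⟨Φ, hΦ⟩ := exists_isGlobalFlow hg hM
  have hc := hΦ.continuous hg hM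
  have hAX' : A ⊆ X := fun x hx => (hAX hx).1
  set P := transportDensity Φ X B
  have hPF : ∀ x, EqOn (fun t => perronFrobenius f X t (chi B) x) (fun t => P (t, x)) (Ioi 0) :=
    fun x t ht => perronFrobenius_chi hΦ hg hc hV hfg hXV (le_of_lt ht) x
  have hrho : rho f X B = fun x => ∫ t in Ioi (0 : ℝ), P (t, x) :=
    funext fun x => setIntegral_congr_fun measurableSet_Ioi (hPF x)
  have hgram : controllabilityGramian f X B (chi A) = A.indicator (rho f X B) := by
    ext x
    by_cases hx : x ∈ A <;>
      simp [controllabilityGramian, rho, gramianIntegrand_chi hΦ hg hV hfg hXV, hx]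
  have hPm : Measurable P := measurable_transportDensity hc hX.isClosed hB
  have htotal : totalTime f X B A = ∫⁻ p, ENNReal.ofReal (P p)
      ∂((volume.restrict (Ioi (0 : ℝ))).prod (volume.restrict A)) := by
    rw [totalTime_eq hΦ hg hc hX.isClosed hV hfg hXV hA hB,
      lintegral_transportDensity hΦ hg hc hX.isClosed hA hB]
  -- Joint integrability on `(0, ∞) × A` carries all the convergence claims and permits passing from
  -- `ℝ≥0∞`-valued to real integrals.
  have hPint : Integrable P ((volume.restrict (Ioi (0 : ℝ))).prod (volume.restrict A)) := by
    refine ⟨hPm.aestronglyMeasurable, ?_⟩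
    rw [hasFiniteIntegral_iff_ofReal (.of_forall transportDensity_nonneg), ← htotal]
    exact totalTime_lt_top hX hstable hΦ hg hc hV hfg hXV hA hB hAX fun x hx => (hBX hx).1
  have hrho_ae : ∀ᵐ x ∂(volume.restrict A),
      IntegrableOn (fun t => perronFrobenius f X t (chi B) x) (Ioi 0) := by
    filter_upwards [hPint.prod_left_ae] with x hx
    exact IntegrableOn.congr_fun hx (hPF x).symm measurableSet_Ioi
  have hrho_int : IntegrableOn (rho f X B) A := by
    rw [hrho]
    exact hPint.integral_prod_right
  have hint_eq : (∫ x in X, controllabilityGramian f X B (chi A) x) = ∫ x in A, rho f X B x := by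
    rw [hgram, setIntegral_indicator hA, inter_eq_right.2 hAX']
  have htotal_eq : totalTime f X B A =
      ENNReal.ofReal (∫ x in X, controllabilityGramian f X B (chi A) x) := by
    rw [hint_eq, hrho, ← integral_prod_symm _ hPint,
      ofReal_integral_eq_lintegral_ofReal hPint (.of_forall transportDensity_nonneg), htotal]
  refine ⟨?_, hrho_ae, ?_, hrho_int, hint_eq, htotal_eq, fun hball => ?_⟩
  · refine ae_restrict_of_ae ?_
    filter_upwards [(ae_restrict_iff' hA).1 hrho_ae] with x hx
    by_cases hxA : x ∈ A
    · refine (hx hxA).congr_fun (fun t _ => ?_) measurableSet_Ioi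
      rw [gramianIntegrand_chi hΦ hg hV hfg hXV, indicator_of_mem hxA]
    · refine integrableOn_zero.congr_fun (fun t _ => ?_) measurableSet_Ioi
      rw [gramianIntegrand_chi hΦ hg hV hfg hXV, indicator_of_notMem hxA]
  · rw [hgram]
    exact (hrho_int.integrable_indicator hA).integrableOn
  · rw [residenceTime_eq_totalTime hΦ hg hV hfg hXV hAX hball, htotal_eq]
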